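/- Let $(X,\mathcal A,\mu)$ be a probability space (usually taken to be atomless and standard, but this is not needed). A graphon over it is a symmetric function $W\colon X\times X\to[0,1]$ that is measurable with respect to the completion of the product $\sigma$-algebra. For a finite graph $G$ put $$\phi_W(G)=\frac{|V(G)|!}{|\mathrm{Aut}(G)|}\int_{X^{V(G)}}\prod_{\{v,w\}\in E(G)}W(x_v,x_w)\prod_{\{v,w\}\in E(\overline G)}\bigl(1-W(x_v,x_w)\bigr)\,d\mu^{V(G)}(x),$$ where $\overline G$ is the complement of $G$. For finite graphs $M,N$ let $p(M,N)$ be the proportion of the $|V(M)|$-element subsets of $V(N)$ that induce a copy of $M$ in $N$ (and $p(M,N)=0$ if $|V(M)|>|V(N)|$). A sequence $(N_k)_{k\in\mathbb N}$ of finite graphs with strictly increasing numbers of vertices converges to a real-valued function $\phi$ on isomorphism classes of finite graphs if $p(M,N_k)\to\phi(M)$ for every finite graph $M$. A subgraphon of $W$ is a function $\psi$ for which there are a real $c>0$, finite graphs $N_k$ and sets $A_k\subseteq V(N_k)$ such that $(N_k)_k$ converges to $\phi_W$, $|A_k|/|V(N_k)|\to c$, and the sequence of induced subgraphs $(N_k|_{A_k})_k$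 converges to $\psi$. Let $Q(\psi)$ be the set of finite graphs $G$ (up to isomorphism) with $\psi(G)>0$. Call $W$ weakly random if $\bigcap_{\psi}Q(\psi)=Q(\phi_W)$, where the intersection is over all subgraphons $\psi$ of $W$. Theorem. If $W$ is a weakly random graphon and there exists a finite graph $G$ with $\phi_W(G)=0$, then $W$ is almost everywhere $\{0,1\}$-valued, that is, $W(x,y)\in\{0,1\}$ for $\mu\otimes\mu$-almost every $(x,y)\in X\times X$. -/

import Mathlib

open MeasureTheory Filter Topology

/-- A graphon over the space `(X, μ)`: a symmetric function `X × X → [0,1]` that is measurable with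
respect to the completion of the product σ-algebra. -/
structure Graphon {X : Type*} [MeasurableSpace X] (μ : Measure X) where
  toFun : X → X → ℝ
  symm' : ∀ x y, toFun x y = toFun y x
  nonneg' : ∀ x y, 0 ≤ toFun x y
  le_one' : ∀ x y, toFun x y ≤ 1
  nullMeasurable' : NullMeasurable (fun p : X × X => toFun p.1 p.2) (μ.prod μ)

/-- Finite graphs up to isomorphism, represented by graphs on the vertex sets `Fin n`
(including the empty graph, `n = 0`). -/
abbrev FinGraph : Type := Σ n : ℕ, SimpleGraph (Fin n)

namespace Graphon

variable {X : Type*} [MeasurableSpace X] {μ : Measure X}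

/-- The value of a graphon at an unordered pair of points. -/
def onPair (W : Graphon μ) : Sym2 X → ℝ :=
  Sym2.lift ⟨W.toFun, W.symm'⟩

open scoped Classical in
/-- The labeled induced density `t_ind(G, W)`. Here `Gᶜ` is the complement of `G`, whose edges are
the pairs of distinct non-adjacent vertices of `G`. -/
noncomputable def tind (W : Graphon μ) {V : Type*} [Fintype V] (G : SimpleGraph V) : ℝ :=
  ∫ x : V → X,
    (∏ e ∈ G.edgeFinset, W.onPair (e.map x)) * (∏ e ∈ Gᶜ.edgeFinset, (1 - W.onPair (e.map x)))
    ∂(Measure.pi fun _ : V => μ)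

/-- The induced density `φ_W(G) = (|G|! / |Aut(G)|) t_ind(G, W)`. -/
noncomputable def density (W : Graphon μ) {V : Type*} [Fintype V] (G : SimpleGraph V) : ℝ :=
  ((Fintype.card V).factorial : ℝ) / (Nat.card (G ≃g G) : ℝ) * W.tind G

/-- The limit `φ_W` represented by `W`, as a function on finite graphs. -/
noncomputable def limit (W : Graphon μ) : FinGraph → ℝ :=
  fun G => W.density G.2

end Graphon

/-- The induced density `p(M, N)` of a finite graph `M` in a finite graph `N`: the proportion of the
`|M|`-element vertex sets of `N` that induce a copy of `M`. It is `0` if `|M| > |N|`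
(numerator and denominator are both `0` then). -/
noncomputable def inducedDensity {V U : Type*} (M : SimpleGraph V) (N : SimpleGraph U) : ℝ :=
  ({A : Set U | Nonempty (N.induce A ≃g M)}.ncard : ℝ) / ((Nat.card U).choose (Nat.card V) : ℝ)

/-- The sequence `N` of finite graphs is convergent, with limit `φ`: the numbers of vertices
increase strictly and `p(M, N k) → φ(M)` for every finite graph `M`. -/
structure GraphsConvergeTo {U : ℕ → Type} [∀ k, Finite (U k)] (N : ∀ k, SimpleGraph (U k))
    (φ : FinGraph → ℝ) : Prop where
  card_strictMono : StrictMono fun k => Nat.card (U k)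
  tendsto : ∀ M : FinGraph, Tendsto (fun k => inducedDensity M.2 (N k)) atTop (𝓝 (φ M))

/-- `ψ` is a subgraphon of `φ` of measure `c > 0`: some sequence of finite graphs converges to `φ`
and has induced subgraphs, of asymptotic relative size `c`, that converge to `ψ`. -/
def IsSubgraphonOfMeasure (ψ φ : FinGraph → ℝ) (c : ℝ) : Prop :=
  0 < c ∧ ∃ (N : ℕ → FinGraph) (A : ∀ k, Set (Fin (N k).1)),
    GraphsConvergeTo (fun k => (N k).2) φ ∧
    Tendsto (fun k => ((A k).ncard : ℝ) / ((N k).1 : ℝ)) atTop (𝓝 c) ∧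
    GraphsConvergeTo (fun k => (N k).2.induce (A k)) ψ

/-- `ψ` is a subgraphon of `φ` (of some positive measure). -/
def IsSubgraphon (ψ φ : FinGraph → ℝ) : Prop :=
  ∃ c : ℝ, IsSubgraphonOfMeasure ψ φ c

/-- `Q(φ)`: the finite graphs of positive density. -/
def positiveGraphs (φ : FinGraph → ℝ) : Set FinGraph :=
  {G | 0 < φ G}

/-- `P(φ)`: the finite graphs that have positive density in all subgraphons. -/
def persistentlyPositiveGraphs (φ : FinGraph → ℝ) : Set FinGraph :=
  ⋂ (ψ : FinGraph → ℝ) (_ : IsSubgraphon ψ φ), positiveGraphs ψ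

/-- A graphon is weakly random if `P(W) = Q(W)`. -/
def Graphon.WeaklyRandom {X : Type*} [MeasurableSpace X] {μ : Measure X} (W : Graphon μ) : Prop :=
  persistentlyPositiveGraphs W.limit = positiveGraphs W.limit

/-! Suppose `W` lies strictly between 0 and 1 on a set `E` of positive measure. Then every finite
graph `M` has positive density (`WeaklyRandom.tind_pos`), by induction on the number of vertices. By
Fubini, for a non-null set of points `y` the slice `A` of `E` at `y` has positive measure. The graph
`M` minus a vertex has positive density in `W` by induction, hence inside `A` by weak randomness.
Let `y` play the missing vertex: since `0 < W(y,z) < 1` for `z` in `A`, any pattern of adjacencies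
to `y` has positive probability. So `M` has positive density.

The longer task is to show that the restriction of `W` to `A` is a subgraphon in the sense of
convergent finite graphs (`isSubgraphon_limitOn`). Sample `n` points and a `W`-random graph on them,
and take as vertex subset the points falling in `A`. Counts of labeled copies concentrate by a
second moment bound (`exists_integrable_bound`), so one sample is nearly correct for any finite list
of graphs, both globally and inside `A` (`eventually_exists_sample`). A diagonal choice gives the
sequence. The random graph at fixed points is handled as a finite sum over all graphs with
coefficients `weight`. -/

namespace Graphon

/-! ### The random graph at fixed sample points -/

section Weight

variable {X : Type*} [MeasurableSpace X] {μ : Measure X} (W : Graphon μ)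
variable {U V V' : Type*} [Fintype U] [Fintype V] [Fintype V']

open scoped Classical in
/-- The probability that the graph sampled from `W` at the points `x` is equal to `G`. -/
noncomputable def weight (G : SimpleGraph V) (x : V → X) : ℝ :=
  (∏ e ∈ G.edgeFinset, W.onPair (e.map x)) * (∏ e ∈ Gᶜ.edgeFinset, (1 - W.onPair (e.map x)))

theorem tind_eq_integral_weight (G : SimpleGraph V) :
    W.tind G = ∫ x, W.weight G x ∂(Measure.pi fun _ : V => μ) := rfl

@[simp]
theorem onPair_mk (x y : X) : W.onPair s(x, y) = W.toFun x y := rfl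

theorem onPair_nonneg (e : Sym2 X) : 0 ≤ W.onPair e := by
  induction e with | _ x y => exact W.nonneg' x y

theorem onPair_le_one (e : Sym2 X) : W.onPair e ≤ 1 := by
  induction e with | _ x y => exact W.le_one' x y

theorem weight_nonneg (G : SimpleGraph V) (x : V → X) : 0 ≤ W.weight G x :=
  mul_nonneg (Finset.prod_nonneg fun _ _ => W.onPair_nonneg _)
    (Finset.prod_nonneg fun _ _ => sub_nonneg.2 (W.onPair_le_one _))

theorem weight_le_one (G : SimpleGraph V) (x : V → X) : W.weight G x ≤ 1 :=
  mul_le_one₀ (Finset.prod_le_one (fun _ _ => W.onPair_nonneg _) fun _ _ => W.onPair_le_one _)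
    (Finset.prod_nonneg fun _ _ => sub_nonneg.2 (W.onPair_le_one _))
    (Finset.prod_le_one (fun _ _ => sub_nonneg.2 (W.onPair_le_one _))
      fun _ _ => sub_le_self _ (W.onPair_nonneg _))

theorem weight_eq_zero_iff (G : SimpleGraph V) (x : V → X) :
    W.weight G x = 0 ↔ ∃ v w, v ≠ w ∧
      (G.Adj v w ∧ W.toFun (x v) (x w) = 0 ∨ ¬ G.Adj v w ∧ W.toFun (x v) (x w) = 1) := by
  classical
  unfold weight
  rw [mul_eq_zero, Finset.prod_eq_zero_iff, Finset.prod_eq_zero_iff]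
  constructor
  · rintro (⟨e, he, h⟩ | ⟨e, he, h⟩)
    · induction e with | _ v w =>
      rw [SimpleGraph.mem_edgeFinset, SimpleGraph.mem_edgeSet] at he
      exact ⟨v, w, he.ne, Or.inl ⟨he, h⟩⟩
    · induction e with | _ v w =>
      rw [SimpleGraph.mem_edgeFinset, SimpleGraph.mem_edgeSet, SimpleGraph.compl_adj] at he
      exact ⟨v, w, he.1, Or.inr ⟨he.2, (sub_eq_zero.1 h).symm⟩⟩
  · rintro ⟨v, w, hvw, ⟨ha, h⟩ | ⟨ha, h⟩⟩
    · exact Or.inl ⟨s(v, w), by simpa using ha, by simpa using h⟩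
    · exact Or.inr ⟨s(v, w), by simpa using ⟨hvw, ha⟩, by simp [h]⟩

open scoped Classical in
/-- The probability that the graph sampled from `W` at the points `x` contains the pairs in `P`
as edges and those in `Q` as non-edges. -/
theorem sum_indicator_weight [Fintype (SimpleGraph U)] (x : U → X) (P Q : Finset (Sym2 U))
    (hP : ∀ e ∈ P, ¬ e.IsDiag) (hQ : ∀ e ∈ Q, ¬ e.IsDiag) (hPQ : Disjoint P Q) :
    ∑ N : SimpleGraph U, {N : SimpleGraph U | (∀ e ∈ P, e ∈ N.edgeSet) ∧
      ∀ e ∈ Q, e ∉ N.edgeSet}.indicator (fun N => W.weight N x) N =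
    (∏ e ∈ P, W.onPair (e.map x)) * ∏ e ∈ Q, (1 - W.onPair (e.map x)) := by
  set D : Finset (Sym2 U) := Finset.univ.filter fun e => ¬ e.IsDiag with hD
  -- Expanding `∏ (a e + b e)` over `D` sums over all edge sets: `a` selects an edge, `b` a
  -- non-edge. The zeros kill the choices forbidden by `P` and `Q`; a pair in neither contributes
  -- the factor 1.
  set a : Sym2 U → ℝ := fun e => if e ∈ Q then 0 else W.onPair (e.map x)
  set b : Sym2 U → ℝ := fun e => if e ∈ P then 0 else 1 - W.onPair (e.map x)
  have hPD : P ⊆ D := fun e he => by simp [hD, hP e he]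
  have hQD : Q ⊆ D := fun e he => by simp [hD, hQ e he]
  have hdis : ∀ e ∈ P, e ∉ Q := fun e he => Finset.disjoint_left.1 hPQ he
  have key : ∏ e ∈ D, (a e + b e) =
      (∏ e ∈ P, W.onPair (e.map x)) * ∏ e ∈ Q, (1 - W.onPair (e.map x)) := by
    rw [← Finset.prod_subset (Finset.union_subset hPD hQD), Finset.prod_union hPQ]
    · congr 1
      · exact Finset.prod_congr rfl fun e he => by simp [a, b, he, hdis e he]
      · refine Finset.prod_congr rfl fun e he => ?_
        have : e ∉ P := fun h => hdis e h he
        simp [a, b, he, this]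
    · intro e _ he
      rw [Finset.mem_union, not_or] at he
      simp [a, b, he.1, he.2]
  rw [← key, Finset.prod_add]
  refine Finset.sum_nbij' (fun N => N.edgeFinset) (fun t => SimpleGraph.fromEdgeSet (t : Set _))
    ?_ ?_ ?_ ?_ ?_
  · intro N _
    rw [Finset.mem_powerset]
    intro e he
    simpa [hD] using N.not_isDiag_of_mem_edgeFinset he
  · simp
  · intro N _
    simp
  · intro t ht
    rw [Finset.mem_powerset] at ht
    ext e
    simp only [SimpleGraph.mem_edgeFinset, SimpleGraph.edgeSet_fromEdgeSet, Set.mem_sdiff,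
      Finset.mem_coe, Sym2.mem_diagSet, and_iff_left_iff_imp]
    intro he
    simpa [hD] using ht he
  · intro N _
    have hc : D \ N.edgeFinset = Nᶜ.edgeFinset := by
      ext e
      induction e with | _ v w => simp [hD, SimpleGraph.compl_adj]
    rw [hc]
    by_cases hN : (∀ e ∈ P, e ∈ N.edgeSet) ∧ ∀ e ∈ Q, e ∉ N.edgeSet
    · rw [Set.indicator_of_mem (by exact hN), weight]
      congr 1
      · refine Finset.prod_congr rfl fun e he => ?_
        have : e ∉ Q := fun h => hN.2 e h (by simpa using he)
        simp [a, this]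
      · refine Finset.prod_congr rfl fun e he => ?_
        have : e ∉ P := by
          intro h
          have h1 := hN.1 e h
          induction e with | _ v w =>
          simp only [SimpleGraph.mem_edgeFinset, SimpleGraph.mem_edgeSet,
            SimpleGraph.compl_adj] at he h1
          exact he.2 h1
        simp [b, this]
    · rw [Set.indicator_of_notMem (by exact hN)]
      symm
      rw [not_and_or] at hN
      push Not at hN
      rcases hN with ⟨e, he, h⟩ | ⟨e, he, h⟩
      · refine mul_eq_zero_of_right _ (Finset.prod_eq_zero (i := e) ?_ (by simp [b, he]))
        rw [← hc, Finset.mem_sdiff]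
        exact ⟨hPD he, by simpa using h⟩
      · exact mul_eq_zero_of_left (Finset.prod_eq_zero (i := e) (by simpa using h)
          (by simp [a, he])) _

theorem sum_weight [Fintype (SimpleGraph U)] (x : U → X) :
    ∑ N : SimpleGraph U, W.weight N x = 1 := by
  have h := W.sum_indicator_weight x ∅ ∅ (by simp) (by simp) (by simp)
  simpa using h

end Weight

end Graphon

/-! ### Edge sets under injective maps, and independence of disjoint pieces -/

open scoped Classical in
theorem SimpleGraph.disjoint_image_edgeFinset_compl {U V : Type*} [Fintype V] (M : SimpleGraph V)
    {f : V → U} (hf : Function.Injective f) :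
    Disjoint (M.edgeFinset.image (Sym2.map f)) (Mᶜ.edgeFinset.image (Sym2.map f)) := by
  rw [Finset.disjoint_image (Sym2.map.injective hf), Finset.disjoint_left]
  intro e he
  induction e with | _ v w => simp_all

open scoped Classical in
theorem SimpleGraph.not_isDiag_of_mem_image_edgeFinset {U V : Type*}
    (M : SimpleGraph V) [Fintype M.edgeSet] {f : V → U} (hf : Function.Injective f) {e : Sym2 U}
    (he : e ∈ M.edgeFinset.image (Sym2.map f)) : ¬ e.IsDiag := by
  obtain ⟨e, h, rfl⟩ := Finset.mem_image.1 he
  rw [Sym2.isDiag_map hf]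
  exact M.not_isDiag_of_mem_edgeFinset h

open scoped Classical in
theorem Sym2.disjoint_image_map {U V V' : Type*} (A : Finset (Sym2 V)) (B : Finset (Sym2 V'))
    {f : V → U} {g : V' → U} (hne : ∀ v w, f v ≠ g w) :
    Disjoint (A.image (Sym2.map f)) (B.image (Sym2.map g)) := by
  rw [Finset.disjoint_left]
  simp only [Finset.mem_image, not_exists, not_and]
  rintro _ ⟨e, -, rfl⟩ e' -
  induction e with | _ v w =>
  induction e' with | _ v' w' =>
  intro h
  have : g v' ∈ s(f v, f w) := by
    rw [Sym2.map_mk, Sym2.map_mk] at h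
    rw [← h]; simp
  rcases Sym2.mem_iff.1 this with h | h
  · exact hne _ _ h.symm
  · exact hne _ _ h.symm

open scoped Classical in
theorem SimpleGraph.comap_eq_iff_edges {U V : Type*} [Fintype V] (M : SimpleGraph V)
    (N : SimpleGraph U) (f : V → U) :
    N.comap f = M ↔ (∀ e ∈ M.edgeFinset.image (Sym2.map f), e ∈ N.edgeSet) ∧
      ∀ e ∈ Mᶜ.edgeFinset.image (Sym2.map f), e ∉ N.edgeSet := by
  simp only [Finset.mem_image, SimpleGraph.mem_edgeFinset, forall_exists_index, and_imp,
    forall_apply_eq_imp_iff₂]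
  constructor
  · rintro rfl
    constructor
    · intro e he
      induction e with | _ v w => simpa using he
    · intro e he
      induction e with | _ v w => simpa using (SimpleGraph.compl_adj _ _ _).1 he |>.2
  · rintro ⟨h1, h2⟩
    ext v w
    rw [SimpleGraph.comap_adj]
    by_cases hvw : v = w
    · simp [hvw]
    constructor
    · intro h
      by_contra hn
      exact h2 s(v, w) (by simp [hvw, hn]) (by simpa using h)
    · intro h
      simpa using h1 s(v, w) (by simpa using h)

namespace Graphon

section Weight

variable {X : Type*} [MeasurableSpace X] {μ : Measure X} (W : Graphon μ)
variable {U V V' : Type*} [Fintype U] [Fintype V] [Fintype V']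

open scoped Classical in
theorem weight_comp {U : Type*} (M : SimpleGraph V) {f : V → U} (hf : Function.Injective f) (x : U → X) :
    W.weight M (x ∘ f) = (∏ e ∈ M.edgeFinset.image (Sym2.map f), W.onPair (e.map x)) *
      ∏ e ∈ Mᶜ.edgeFinset.image (Sym2.map f), (1 - W.onPair (e.map x)) := by
  rw [Finset.prod_image (Sym2.map.injective hf).injOn, Finset.prod_image
    (Sym2.map.injective hf).injOn]
  simp only [Sym2.map_map]
  rfl

open scoped Classical in
/-- The graphs induced on disjoint sets of vertices of the sampled graph are independent. -/
theorem sum_weight_mul_indicator_mul_indicator [Fintype (SimpleGraph U)] (x : U → X)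
    (M : SimpleGraph V) (M' : SimpleGraph V') {f : V → U} {g : V' → U}
    (hf : Function.Injective f) (hg : Function.Injective g) (hfg : ∀ v w, f v ≠ g w) :
    ∑ N : SimpleGraph U, W.weight N x * ({N : SimpleGraph U | N.comap f = M}.indicator 1 N *
      {N : SimpleGraph U | N.comap g = M'}.indicator 1 N) =
    W.weight M (x ∘ f) * W.weight M' (x ∘ g) := by
  have h := W.sum_indicator_weight x
    (M.edgeFinset.image (Sym2.map f) ∪ M'.edgeFinset.image (Sym2.map g))
    (Mᶜ.edgeFinset.image (Sym2.map f) ∪ M'ᶜ.edgeFinset.image (Sym2.map g))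
    (fun e he => (Finset.mem_union.1 he).elim
      (fun he => SimpleGraph.not_isDiag_of_mem_image_edgeFinset M hf he)
      (fun he => SimpleGraph.not_isDiag_of_mem_image_edgeFinset M' hg he))
    (fun e he => (Finset.mem_union.1 he).elim
      (fun he => SimpleGraph.not_isDiag_of_mem_image_edgeFinset Mᶜ hf he)
      (fun he => SimpleGraph.not_isDiag_of_mem_image_edgeFinset M'ᶜ hg he))
    (by
      rw [Finset.disjoint_union_left, Finset.disjoint_union_right, Finset.disjoint_union_right]
      exact ⟨⟨M.disjoint_image_edgeFinset_compl hf, Sym2.disjoint_image_map _ _ hfg⟩,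
        (Sym2.disjoint_image_map _ _ hfg).symm, M'.disjoint_image_edgeFinset_compl hg⟩)
  rw [Finset.prod_union (Sym2.disjoint_image_map _ _ hfg),
    Finset.prod_union (Sym2.disjoint_image_map _ _ hfg)] at h
  rw [W.weight_comp M hf, W.weight_comp M' hg, mul_mul_mul_comm, ← h]
  refine Finset.sum_congr rfl fun N _ => ?_
  have hN : N ∈ {N : SimpleGraph U |
      (∀ e ∈ M.edgeFinset.image (Sym2.map f) ∪ M'.edgeFinset.image (Sym2.map g), e ∈ N.edgeSet) ∧
      ∀ e ∈ Mᶜ.edgeFinset.image (Sym2.map f) ∪ M'ᶜ.edgeFinset.image (Sym2.map g),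
        e ∉ N.edgeSet} ↔ N.comap f = M ∧ N.comap g = M' := by
    rw [M.comap_eq_iff_edges N f, M'.comap_eq_iff_edges N g]
    simp only [Set.mem_ofPred_eq, Finset.mem_union, or_imp, forall_and]
    tauto
  by_cases hA : N.comap f = M <;> by_cases hB : N.comap g = M' <;>
    simp only [hA, hB, and_self, and_true, and_false, iff_true, iff_false] at hN
  · rw [Set.indicator_of_mem hN, Set.indicator_of_mem (by exact hA),
      Set.indicator_of_mem (by exact hB)]
    simp
  · rw [Set.indicator_of_notMem hN, Set.indicator_of_notMem (a := N) (s := {N | N.comap g = M'})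
      (by exact hB)]
    simp
  all_goals
    rw [Set.indicator_of_notMem hN, Set.indicator_of_notMem (a := N) (s := {N | N.comap f = M})
      (by exact hA)]
    simp

theorem sum_weight_mul_indicator [Fintype (SimpleGraph U)] (x : U → X)
    (M : SimpleGraph V) {f : V → U} (hf : Function.Injective f) :
    ∑ N : SimpleGraph U, W.weight N x * {N : SimpleGraph U | N.comap f = M}.indicator 1 N =
      W.weight M (x ∘ f) := by
  -- The one-piece formula is the two-piece formula with a second piece on no vertices.
  have h := W.sum_weight_mul_indicator_mul_indicator x M (⊥ : SimpleGraph Empty) hf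
    (g := Empty.elim) (fun v => v.elim) (fun _ v => v.elim)
  have h1 : ∀ N : SimpleGraph U, N.comap Empty.elim = (⊥ : SimpleGraph Empty) :=
    fun N => Subsingleton.elim _ _
  have h2 : W.weight (⊥ : SimpleGraph Empty) (x ∘ Empty.elim) = 1 := by
    rw [← h1 (⊥ : SimpleGraph U)]
    unfold weight
    rw [Finset.prod_of_isEmpty, Finset.prod_of_isEmpty, one_mul]
  simpa [h1, h2] using h

end Weight

end Graphon

/-! ### Integrals of weights over sample points -/

/-- The preimage of a box is a box: its side at `f v` is `s v`, and its side off the range of `f` is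
all of `X`, of mass 1. -/
theorem MeasureTheory.measurePreserving_comp_injective {X : Type*} [MeasurableSpace X]
    (μ : Measure X) [IsProbabilityMeasure μ] {U V : Type*} [Fintype U] [Fintype V] {f : V → U}
    (hf : Function.Injective f) :
    MeasurePreserving (fun x : U → X => x ∘ f) (Measure.pi fun _ => μ) (Measure.pi fun _ => μ) := by
  classical
  have hm : Measurable fun x : U → X => x ∘ f :=
    measurable_pi_lambda _ fun v => measurable_pi_apply (f v)
  refine ⟨hm, (Measure.pi_eq fun s hs => ?_).symm⟩
  rw [Measure.map_apply hm (MeasurableSet.univ_pi hs)]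
  have hpre : (fun x : U → X => x ∘ f) ⁻¹' Set.univ.pi s =
      Set.univ.pi fun u => ⋂ (v : V) (_ : f v = u), s v := by
    ext x
    simp only [Set.mem_preimage, Set.mem_univ_pi, Set.mem_iInter, Function.comp_apply]
    exact ⟨fun h u v hv => hv ▸ h v, fun h v => h _ v rfl⟩
  have hfv : ∀ v, μ (⋂ (w : V) (_ : f w = f v), s w) = μ (s v) := by
    intro v
    congr 1
    ext x
    simp only [Set.mem_iInter]
    exact ⟨fun h => h v rfl, fun h w hw => hf hw ▸ h⟩
  rw [hpre, Measure.pi_pi, ← Finset.prod_subset (Finset.subset_univ (Finset.univ.image f)),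
    Finset.prod_image hf.injOn]
  · exact Finset.prod_congr rfl fun v _ => hfv v
  · intro u _ hu
    have : ∀ v, f v ≠ u := fun v hv => hu (by simp [← hv])
    simp [this]

namespace Graphon

section SecondMoment

variable {X : Type*} [MeasurableSpace X] {μ : Measure X} [IsProbabilityMeasure μ] (W : Graphon μ)
variable {U V : Type*} [Fintype U] [Fintype V]

/-- Evaluation at two distinct coordinates preserves measure, so null-measurability of `W` pulls
back. On the diagonal nothing is known about measurability, hence the hypothesis on `e`. -/
theorem aemeasurable_onPair_map {e : Sym2 V} (he : ¬ e.IsDiag) :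
    AEMeasurable (fun x : V → X => W.onPair (e.map x)) (Measure.pi fun _ => μ) := by
  induction e with | _ v w =>
  have hvw : v ≠ w := by simpa using he
  have hinj : Function.Injective ![v, w] := by
    intro i j
    fin_cases i <;> fin_cases j <;> simp [hvw, hvw.symm]
  have h1 := (measurePreserving_finTwoArrow μ).comp (measurePreserving_comp_injective μ hinj)
  have h2 := (W.nullMeasurable'.aemeasurable).comp_quasiMeasurePreserving h1.quasiMeasurePreserving
  exact h2

theorem aemeasurable_weight (M : SimpleGraph V) :
    AEMeasurable (W.weight M) (Measure.pi fun _ => μ) := by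
  classical
  refine AEMeasurable.mul (Finset.aemeasurable_fun_prod _ fun e he => ?_)
    (Finset.aemeasurable_fun_prod _ fun e he => ?_)
  · exact W.aemeasurable_onPair_map (M.not_isDiag_of_mem_edgeFinset he)
  · exact (W.aemeasurable_onPair_map (Mᶜ.not_isDiag_of_mem_edgeFinset he)).const_sub 1

/-- The probability that the graph sampled from `W` at `x` is `M`, set to zero unless all the
points lie in `A`. -/
noncomputable def weightOn (A : Set X) (M : SimpleGraph V) : (V → X) → ℝ :=
  (Set.univ.pi fun _ => A).indicator (W.weight M)

/-- The probability that random points of `X` lie in `A` and the graph sampled at them is `M`. -/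
noncomputable def tindOn (A : Set X) (M : SimpleGraph V) : ℝ :=
  ∫ x, W.weightOn A M x ∂(Measure.pi fun _ : V => μ)

omit [IsProbabilityMeasure μ] in
theorem tindOn_univ (M : SimpleGraph V) : W.tindOn Set.univ M = W.tind M := by
  rw [tind_eq_integral_weight]
  simp [tindOn, weightOn]

omit [IsProbabilityMeasure μ] in
theorem weightOn_nonneg (A : Set X) (M : SimpleGraph V) (x : V → X) : 0 ≤ W.weightOn A M x :=
  Set.indicator_nonneg (fun _ _ => W.weight_nonneg _ _) _

omit [IsProbabilityMeasure μ] in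
theorem weightOn_le_one (A : Set X) (M : SimpleGraph V) (x : V → X) : W.weightOn A M x ≤ 1 :=
  Set.indicator_le' (fun _ _ => W.weight_le_one _ _) (fun _ _ => zero_le_one) _

variable {A : Set X} (hA : MeasurableSet A)
include hA

theorem integrable_weightOn (M : SimpleGraph V) :
    Integrable (W.weightOn A M) (Measure.pi fun _ => μ) := by
  refine Integrable.of_bound (C := 1) ?_ (ae_of_all _ fun x => ?_)
  · exact ((W.aemeasurable_weight M).indicator
      (MeasurableSet.univ_pi fun _ => hA)).aestronglyMeasurable
  · rw [Real.norm_of_nonneg (W.weightOn_nonneg A M x)]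
    exact W.weightOn_le_one A M x

theorem integrable_weightOn_comp (M : SimpleGraph V) {f : V → U} (hf : Function.Injective f) :
    Integrable (fun x : U → X => W.weightOn A M (x ∘ f)) (Measure.pi fun _ => μ) :=
  (measurePreserving_comp_injective μ hf).integrable_comp_of_integrable
    (W.integrable_weightOn hA M)

theorem integral_weightOn_comp (M : SimpleGraph V) {f : V → U} (hf : Function.Injective f) :
    ∫ x : U → X, W.weightOn A M (x ∘ f) ∂(Measure.pi fun _ => μ) = W.tindOn A M := by
  have h := measurePreserving_comp_injective μ hf
  rw [tindOn, ← h.map_eq, integral_map h.measurable.aemeasurable]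
  rw [h.map_eq]
  exact (W.integrable_weightOn hA M).aestronglyMeasurable

theorem integrable_weightOn_comp_mul (M : SimpleGraph V) {f g : V → U} (hf : Function.Injective f)
    (hg : Function.Injective g) :
    Integrable (fun x : U → X => W.weightOn A M (x ∘ f) * W.weightOn A M (x ∘ g))
      (Measure.pi fun _ => μ) := by
  refine (W.integrable_weightOn_comp hA M hg).bdd_mul (c := 1)
    (W.integrable_weightOn_comp hA M hf).aestronglyMeasurable (ae_of_all _ fun x => ?_)
  rw [Real.norm_of_nonneg (W.weightOn_nonneg A M _)]
  exact W.weightOn_le_one A M _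

theorem integral_weightOn_comp_mul (M : SimpleGraph V) {f g : V → U} (hf : Function.Injective f)
    (hg : Function.Injective g) (hfg : ∀ v w, f v ≠ g w) :
    ∫ x : U → X, W.weightOn A M (x ∘ f) * W.weightOn A M (x ∘ g) ∂(Measure.pi fun _ => μ) =
      W.tindOn A M ^ 2 := by
  have hs : Function.Injective (Sum.elim f g) := Function.Injective.sumElim hf hg hfg
  have h := (measurePreserving_sumPiEquivProdPi fun _ : V ⊕ V => μ).comp
    (measurePreserving_comp_injective μ hs)
  have hi := (W.integrable_weightOn hA M).mul_prod (W.integrable_weightOn hA M)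
  rw [pow_two, tindOn, ← integral_prod_mul, ← h.map_eq, integral_map h.measurable.aemeasurable]
  · rfl
  · rw [h.map_eq]
    exact hi.aestronglyMeasurable

end SecondMoment

end Graphon

/-! ### Labeled copies and their second moment -/

/-- The labeled induced copies of `M` in `N` with vertices in `S`. -/
def SimpleGraph.labeledCopies {U V : Type*} (M : SimpleGraph V) (N : SimpleGraph U) (S : Set U) :
    Set (V ↪ U) :=
  {f | N.comap f = M ∧ ∀ v, f v ∈ S}

theorem SimpleGraph.ncard_labeledCopies {U V : Type*} [Fintype (V ↪ U)] (M : SimpleGraph V)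
    (N : SimpleGraph U) (S : Set U) :
    ((M.labeledCopies N S).ncard : ℝ) = ∑ f, (M.labeledCopies N S).indicator (fun _ => (1 : ℝ)) f := by
  classical
  rw [Set.ncard_eq_toFinset_card', Set.toFinset_card]
  simp [Set.indicator_apply, Fintype.card_subtype]

theorem card_filter_disjoint_embeddings {U V : Type*} [Fintype (V ↪ U)] [Fintype (V ⊕ V ↪ U)]
    [DecidablePred fun p : (V ↪ U) × (V ↪ U) => ∀ v w, p.1 v ≠ p.2 w] :
    (Finset.univ.filter fun p : (V ↪ U) × (V ↪ U) => ∀ v w, p.1 v ≠ p.2 w).card =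
      Fintype.card (V ⊕ V ↪ U) := by
  rw [← Fintype.card_subtype]
  refine Fintype.card_congr ⟨fun p => ⟨Sum.elim p.1.1 p.1.2,
    Function.Injective.sumElim p.1.1.injective p.1.2.injective p.2⟩,
    fun h => ⟨(Function.Embedding.inl.trans h, Function.Embedding.inr.trans h),
      fun v w hvw => by simpa using h.injective hvw⟩, fun p => ?_, fun h => ?_⟩
  · ext <;> rfl
  · ext v
    cases v <;> rfl

namespace Graphon

section SecondMoment

variable {X : Type*} [MeasurableSpace X] {μ : Measure X} (W : Graphon μ)
variable {U V : Type*} [Fintype U] [Fintype V] [Fintype (SimpleGraph U)] (A : Set X)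

omit [MeasurableSpace X] [Fintype U] [Fintype V] [Fintype (SimpleGraph U)] in
theorem indicator_labeledCopies (M : SimpleGraph V) (N : SimpleGraph U) (x : U → X) (f : V ↪ U) :
    (M.labeledCopies N (x ⁻¹' A)).indicator (fun _ => (1 : ℝ)) f =
      (Set.univ.pi fun _ => A).indicator 1 (x ∘ f) *
        {N : SimpleGraph U | N.comap f = M}.indicator 1 N := by
  classical
  simp only [Set.indicator_apply, SimpleGraph.labeledCopies, Set.mem_ofPred_eq, Set.mem_preimage,
    Set.mem_univ_pi, Function.comp_apply, Pi.one_apply]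
  rw [ite_zero_mul_ite_zero, one_mul]
  exact if_congr and_comm rfl rfl

theorem sum_weight_mul_indicator_labeledCopies (M : SimpleGraph V) (x : U → X) (f : V ↪ U) :
    ∑ N, W.weight N x * (M.labeledCopies N (x ⁻¹' A)).indicator (fun _ => (1 : ℝ)) f =
      W.weightOn A M (x ∘ f) := by
  simp_rw [indicator_labeledCopies, mul_left_comm (W.weight _ _)]
  rw [← Finset.mul_sum, W.sum_weight_mul_indicator x M f.injective, weightOn]
  by_cases h : x ∘ f ∈ Set.univ.pi fun _ => A <;> simp [h]

theorem sum_weight_mul_indicator_labeledCopies_mul (M : SimpleGraph V) (x : U → X) (f g : V ↪ U)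
    (hfg : ∀ v w, f v ≠ g w) :
    ∑ N, W.weight N x * ((M.labeledCopies N (x ⁻¹' A)).indicator (fun _ => (1 : ℝ)) f *
      (M.labeledCopies N (x ⁻¹' A)).indicator (fun _ => (1 : ℝ)) g) =
      W.weightOn A M (x ∘ f) * W.weightOn A M (x ∘ g) := by
  have h : ∀ a b c d e : ℝ, e * (a * b * (c * d)) = a * c * (e * (b * d)) := by intros; ring
  simp_rw [indicator_labeledCopies, h]
  rw [← Finset.mul_sum, W.sum_weight_mul_indicator_mul_indicator x M M f.injective g.injective hfg,
    weightOn]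
  by_cases h : x ∘ f ∈ Set.univ.pi fun _ => A <;> by_cases h' : x ∘ g ∈ Set.univ.pi fun _ => A <;>
    simp [h, h']

omit [Fintype V] in
theorem sum_weight_mul_indicator_labeledCopies_mul_le_one (M : SimpleGraph V) (x : U → X)
    (f g : V ↪ U) :
    ∑ N, W.weight N x * ((M.labeledCopies N (x ⁻¹' A)).indicator (fun _ => (1 : ℝ)) f *
      (M.labeledCopies N (x ⁻¹' A)).indicator (fun _ => (1 : ℝ)) g) ≤ 1 := by
  refine le_of_le_of_eq (Finset.sum_le_sum fun N _ =>
    mul_le_of_le_one_right (W.weight_nonneg _ _) ?_) (W.sum_weight x)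
  have h : ∀ f, (M.labeledCopies N (x ⁻¹' A)).indicator (fun _ => (1 : ℝ)) f ≤ 1 :=
    Set.indicator_le' (fun _ _ => le_rfl) fun _ _ => zero_le_one
  exact mul_le_one₀ (h f) (Set.indicator_nonneg (fun _ _ => zero_le_one) _) (h g)

open scoped Classical in
/-- The second moment bound for the number of labeled copies in the sampled graph. -/
theorem exists_integrable_bound [IsProbabilityMeasure μ] {A : Set X} (hA : MeasurableSet A)
    [Fintype (V ↪ U)] [Fintype (V ⊕ V ↪ U)] (M : SimpleGraph V) :
    ∃ R : (U → X) → ℝ, Integrable R (Measure.pi fun _ => μ) ∧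
      (∀ x, ∑ N, W.weight N x * (((M.labeledCopies N (x ⁻¹' A)).ncard : ℝ) -
        Fintype.card (V ↪ U) * W.tindOn A M) ^ 2 ≤ R x) ∧
      ∫ x, R x ∂(Measure.pi fun _ => μ) ≤
        (Fintype.card (V ↪ U) : ℝ) ^ 2 - Fintype.card (V ⊕ V ↪ U) := by
  set K : ℝ := (Fintype.card (V ↪ U) : ℝ) with hK
  set t := W.tindOn A M with ht
  have hint : ∀ p : (V ↪ U) × (V ↪ U), Integrable (fun x : U → X =>
      if ∀ v w, p.1 v ≠ p.2 w then W.weightOn A M (x ∘ p.1) * W.weightOn A M (x ∘ p.2) else 1)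
      (Measure.pi fun _ => μ) := by
    intro p
    split_ifs
    · exact W.integrable_weightOn_comp_mul hA M p.1.injective p.2.injective
    · exact integrable_const _
  have hint1 : Integrable (fun x : U → X => ∑ p : (V ↪ U) × (V ↪ U),
      if ∀ v w, p.1 v ≠ p.2 w then W.weightOn A M (x ∘ p.1) * W.weightOn A M (x ∘ p.2) else 1)
      (Measure.pi fun _ => μ) := integrable_finsetSum _ fun p _ => hint p
  have hint2 : Integrable (fun x : U → X => 2 * (K * t) * ∑ f : V ↪ U, W.weightOn A M (x ∘ f))
      (Measure.pi fun _ => μ) :=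
    (integrable_finsetSum _ fun f _ => W.integrable_weightOn_comp hA M f.injective).const_mul _
  -- The expanded square. Pairs of embeddings with disjoint images are independent and give a
  -- product; overlapping pairs are bounded by 1.
  refine ⟨fun x => (∑ p : (V ↪ U) × (V ↪ U), if ∀ v w, p.1 v ≠ p.2 w then
      W.weightOn A M (x ∘ p.1) * W.weightOn A M (x ∘ p.2) else 1) -
    2 * (K * t) * ∑ f : V ↪ U, W.weightOn A M (x ∘ f) + (K * t) ^ 2,
    (hint1.sub hint2).add (integrable_const _), fun x => ?_, ?_⟩
  · have hexp : ∀ N : SimpleGraph U, W.weight N x * (((M.labeledCopies N (x ⁻¹' A)).ncard : ℝ) -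
        K * t) ^ 2 =
        (∑ p : (V ↪ U) × (V ↪ U), W.weight N x *
          ((M.labeledCopies N (x ⁻¹' A)).indicator (fun _ => (1 : ℝ)) p.1 *
          (M.labeledCopies N (x ⁻¹' A)).indicator (fun _ => (1 : ℝ)) p.2)) -
        2 * (K * t) * (∑ f, W.weight N x *
          (M.labeledCopies N (x ⁻¹' A)).indicator (fun _ => (1 : ℝ)) f) + W.weight N x * (K * t) ^ 2 := by
      intro N
      rw [← Finset.mul_sum, ← Finset.mul_sum, Fintype.sum_prod_type, ← Finset.sum_mul_sum,
        ← SimpleGraph.ncard_labeledCopies]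
      ring
    simp_rw [hexp]
    rw [Finset.sum_add_distrib, Finset.sum_sub_distrib, ← Finset.sum_mul, W.sum_weight, one_mul,
      ← Finset.mul_sum, Finset.sum_comm, Finset.sum_comm (t := (Finset.univ : Finset (V ↪ U)))]
    simp_rw [sum_weight_mul_indicator_labeledCopies]
    gcongr with p
    split_ifs with h
    · exact (W.sum_weight_mul_indicator_labeledCopies_mul A M x p.1 p.2 h).le
    · exact W.sum_weight_mul_indicator_labeledCopies_mul_le_one A M x p.1 p.2
  -- After summation over pairs the terms in `K ^ 2 * t ^ 2` cancel, leaving only the number of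
  -- overlapping pairs.
  · have h1 : ∀ p : (V ↪ U) × (V ↪ U), ∫ x : U → X,
        (if ∀ v w, p.1 v ≠ p.2 w then W.weightOn A M (x ∘ p.1) * W.weightOn A M (x ∘ p.2) else 1)
        ∂(Measure.pi fun _ => μ) ≤ t ^ 2 + (1 - if ∀ v w, p.1 v ≠ p.2 w then 1 else 0) := by
      intro p
      split_ifs with h
      · rw [W.integral_weightOn_comp_mul hA M p.1.injective p.2.injective h]
        simp [ht]
      · simp [sq_nonneg]
    have hint3 := hint1.sub hint2
    simp only [Pi.sub_def] at hint3
    beta_reduce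
    rw [integral_add hint3 (integrable_const _), integral_sub hint1 hint2,
      integral_finsetSum _ fun p _ => hint p, integral_const_mul,
      integral_finsetSum _ fun f _ => W.integrable_weightOn_comp hA M f.injective]
    simp_rw [fun f : V ↪ U => W.integral_weightOn_comp hA M f.injective]
    have h2 := Finset.sum_le_sum fun p (_ : p ∈ Finset.univ) => h1 p
    rw [Finset.sum_add_distrib, Finset.sum_sub_distrib, Finset.sum_boole,
      card_filter_disjoint_embeddings] at h2
    simp only [Finset.sum_const, Finset.card_univ, Fintype.card_prod, nsmul_eq_mul, mul_one,
      Nat.cast_mul, ← hK, ← ht, integral_const, probReal_univ, smul_eq_mul, one_mul] at h2 ⊢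
    nlinarith [h2]

end SecondMoment

end Graphon

/-! ### Induced densities in terms of labeled copies -/

theorem Nat.tendsto_descFactorial_div_pow (k : ℕ) :
    Tendsto (fun n : ℕ => (n.descFactorial k : ℝ) / (n : ℝ) ^ k) atTop (𝓝 1) := by
  refine (Asymptotics.isEquivalent_iff_tendsto_one ?_).1 (isEquivalent_descFactorial k)
  filter_upwards [eventually_gt_atTop 0] with n hn
  positivity

theorem Nat.tendsto_descFactorial_two_mul_div (k : ℕ) :
    Tendsto (fun n : ℕ => (n.descFactorial (k + k) : ℝ) / (n.descFactorial k : ℝ) ^ 2) atTop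
      (𝓝 1) := by
  have h := (tendsto_descFactorial_div_pow (k + k)).div
    ((tendsto_descFactorial_div_pow k).pow 2) (by norm_num)
  rw [one_pow, div_one] at h
  refine h.congr' ?_
  filter_upwards [eventually_gt_atTop 0] with n hn
  have : (n : ℝ) ≠ 0 := by positivity
  simp only [Pi.div_apply]
  rw [div_pow, ← pow_mul, mul_two, div_div_div_cancel_right₀ (by positivity)]

theorem SimpleGraph.ncard_labeledCopies_induce {U V : Type*} (M : SimpleGraph V)
    (N : SimpleGraph U) (S : Set U) :
    (M.labeledCopies (N.induce S) Set.univ).ncard = (M.labeledCopies N S).ncard := by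
  refine Set.ncard_congr (fun f _ => f.trans (Function.Embedding.subtype _)) ?_ ?_ ?_
  · rintro f ⟨hf, -⟩
    exact ⟨hf, fun v => (f v).2⟩
  · intro f g _ _ h
    ext v
    exact DFunLike.congr_fun h v
  · rintro f ⟨hf, hS⟩
    exact ⟨⟨fun v => ⟨f v, hS v⟩, fun v w h => f.injective (congrArg Subtype.val h)⟩,
      ⟨hf, fun _ => trivial⟩, rfl⟩

/-- Once an isomorphism `φ A` is fixed for each inducing set `A`, a labeled copy is its image
together with an automorphism of `M`. -/
theorem SimpleGraph.ncard_labeledCopies_univ {U V : Type*} (M : SimpleGraph V)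
    (N : SimpleGraph U) :
    (M.labeledCopies N Set.univ).ncard =
      {A : Set U | Nonempty (N.induce A ≃g M)}.ncard * Nat.card (M ≃g M) := by
  rw [← Nat.card_coe_set_eq, ← Nat.card_coe_set_eq, ← Nat.card_prod]
  symm
  let φ : ∀ A : {A : Set U | Nonempty (N.induce A ≃g M)}, N.induce A.1 ≃g M := fun A => A.2.some
  let F : {A : Set U | Nonempty (N.induce A ≃g M)} × (M ≃g M) → M.labeledCopies N Set.univ :=
    fun p => ⟨(p.2.trans (φ p.1).symm).toEquiv.toEmbedding.trans (Function.Embedding.subtype _), by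
      refine ⟨?_, fun _ => trivial⟩
      ext v w
      exact (p.2.trans (φ p.1).symm).map_rel_iff⟩
  have hF : ∀ p v, (F p).1 v = ((φ p.1).symm (p.2 v) : U) := fun _ _ => rfl
  have hrange : ∀ p, Set.range (F p).1 = p.1.1 := by
    intro p
    ext u
    constructor
    · rintro ⟨v, rfl⟩
      exact ((φ p.1).symm (p.2 v)).2
    · intro hu
      exact ⟨p.2.symm (φ p.1 ⟨u, hu⟩), by simp [hF]⟩
  refine Nat.card_congr (Equiv.ofBijective F ⟨?_, ?_⟩)
  · rintro ⟨A, σ⟩ ⟨B, τ⟩ h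
    have hAB : A = B := Subtype.ext (by rw [← hrange ⟨A, σ⟩, ← hrange ⟨B, τ⟩, h])
    subst hAB
    congr 1
    ext v
    have h1 := congrArg (fun f => f.1 v) h
    simp only [hF] at h1
    exact (φ A).symm.injective (Subtype.ext h1)
  · rintro ⟨f, hf, -⟩
    have hadj : ∀ v w, N.Adj (f v) (f w) ↔ M.Adj v w := by
      intro v w
      rw [← hf]; rfl
    let ψ : M ≃g N.induce (Set.range f) :=
      ⟨Equiv.ofInjective f f.injective, fun {v w} => hadj v w⟩
    refine ⟨⟨⟨Set.range f, ⟨ψ.symm⟩⟩, ψ.trans (φ ⟨Set.range f, ⟨ψ.symm⟩⟩)⟩, ?_⟩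
    apply Subtype.ext
    ext v
    rw [hF]
    simp only [RelIso.trans_apply, RelIso.symm_apply_apply]
    rfl

theorem inducedDensity_eq {U V : Type*} [Fintype V] (M : SimpleGraph V) (N : SimpleGraph U) :
    inducedDensity M N = ((Fintype.card V).factorial : ℝ) / (Nat.card (M ≃g M) : ℝ) *
      ((M.labeledCopies N Set.univ).ncard /
        ((Nat.card U).descFactorial (Fintype.card V) : ℝ)) := by
  have hpos : (0 : ℝ) < Nat.card (M ≃g M) := by
    have : Finite (M ≃g M) := Finite.of_injective _ RelIso.toEquiv_injective
    have : Nonempty (M ≃g M) := ⟨RelIso.refl _⟩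
    exact_mod_cast Nat.card_pos
  have hf : (0 : ℝ) < (Fintype.card V).factorial := by positivity
  rw [inducedDensity, Nat.card_eq_fintype_card (α := V), SimpleGraph.ncard_labeledCopies_univ,
    Nat.descFactorial_eq_factorial_mul_choose]
  push_cast
  -- If the binomial coefficient is 0, both sides are 0 through division by zero.
  rcases eq_or_ne (((Nat.card U).choose (Fintype.card V) : ℕ) : ℝ) 0 with h | h
  · simp [h]
  · field_simp

theorem inducedDensity_induce {U V : Type*} [Fintype V] (M : SimpleGraph V)
    (N : SimpleGraph U) (S : Set U) :
    inducedDensity M (N.induce S) = ((Fintype.card V).factorial : ℝ) / (Nat.card (M ≃g M) : ℝ) *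
      ((M.labeledCopies N S).ncard / (S.ncard.descFactorial (Fintype.card V) : ℝ)) := by
  rw [inducedDensity_eq, Nat.card_coe_set_eq, SimpleGraph.ncard_labeledCopies_induce]

/-- Makes the relative size of a vertex subset a special case of a labeled copy density. -/
theorem SimpleGraph.ncard_labeledCopies_bot_fin_one {U : Type*} (N : SimpleGraph U)
    (S : Set U) : ((⊥ : SimpleGraph (Fin 1)).labeledCopies N S).ncard = S.ncard := by
  symm
  refine Set.ncard_congr (fun u _ => ⟨fun _ => u, fun v w _ => Subsingleton.elim v w⟩) ?_ ?_ ?_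
  · intro u hu
    exact ⟨Subsingleton.elim _ _, fun _ => hu⟩
  · intro u w _ _ h
    exact DFunLike.congr_fun h 0
  · rintro f ⟨-, hf⟩
    refine ⟨f 0, hf 0, ?_⟩
    ext v
    rw [Subsingleton.elim v 0]
    rfl

/-! ### Existence of good samples -/

namespace Graphon

section Sampling

variable {X : Type*} [MeasurableSpace X] {μ : Measure X} [IsProbabilityMeasure μ] (W : Graphon μ)

omit [IsProbabilityMeasure μ] in
theorem weight_of_subsingleton {V : Type*} [Fintype V] [Subsingleton V] (M : SimpleGraph V)
    (x : V → X) : W.weight M x = 1 := by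
  have h : ∀ (G : SimpleGraph V) (_ : Fintype G.edgeSet) (e : Sym2 V), e ∉ G.edgeFinset := by
    intro G _ e he
    rw [SimpleGraph.mem_edgeFinset] at he
    induction e with | _ v w =>
    exact SimpleGraph.Adj.ne he (Subsingleton.elim v w)
  rw [weight, Finset.prod_eq_one fun e he => absurd he (h _ _ e),
    Finset.prod_eq_one fun e he => absurd he (h _ _ e), one_mul]

theorem tindOn_bot_fin_one {A : Set X} (hA : MeasurableSet A) :
    W.tindOn A (⊥ : SimpleGraph (Fin 1)) = μ.real A := by
  have h : W.weight (⊥ : SimpleGraph (Fin 1)) = fun _ => 1 :=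
    funext fun x => W.weight_of_subsingleton _ x
  rw [tindOn, weightOn, h, integral_indicator (MeasurableSet.univ_pi fun _ => hA)]
  simp [measureReal_def, Measure.pi_pi]

/-- The mean, over points and graphs, of the summed squared deviations is at most the sum of `1 -
n.descFactorial (2k) / (n.descFactorial k)^2`, with `k` the size of each graph. This tends to 0, so
some outcome lies below `ε ^ 2`. -/
theorem eventually_exists_sample {ι : Type*} (s : Finset ι) (M : ι → FinGraph) {A : ι → Set X}
    (hA : ∀ i, MeasurableSet (A i)) {ε : ℝ} (hε : 0 < ε) :
    ∀ᶠ n : ℕ in atTop, ∃ (x : Fin n → X) (N : SimpleGraph (Fin n)), ∀ i ∈ s,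
      |(((M i).2.labeledCopies N (x ⁻¹' A i)).ncard : ℝ) / (n.descFactorial (M i).1 : ℝ) -
        W.tindOn (A i) (M i).2| < ε := by
  have hlim : Tendsto (fun n : ℕ => ∑ i ∈ s, (1 - (n.descFactorial ((M i).1 + (M i).1) : ℝ) /
      (n.descFactorial (M i).1 : ℝ) ^ 2)) atTop (𝓝 0) := by
    have := tendsto_finsetSum s fun i _ =>
      (Nat.tendsto_descFactorial_two_mul_div (M i).1).const_sub 1
    simpa using this
  filter_upwards [hlim.eventually_lt_const (by positivity : 0 < ε ^ 2),
    (Filter.eventually_all_finset s).2 fun i _ => eventually_ge_atTop (M i).1] with n hn hle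
  choose R hRi hR hRint using fun i => W.exists_integrable_bound (U := Fin n) (hA i) (M i).2
  simp only [Fintype.card_embedding_eq, Fintype.card_sum, Fintype.card_fin] at hR hRint
  set K : ι → ℝ := fun i => (n.descFactorial (M i).1 : ℝ) with hK
  have hKpos : ∀ i ∈ s, 0 < K i := fun i hi =>
    Nat.cast_pos.2 (Nat.descFactorial_pos.2 (hle i hi))
  obtain ⟨x, hx⟩ := exists_le_integral (μ := Measure.pi fun _ : Fin n => μ)
    (integrable_finsetSum s fun i _ => (hRi i).div_const (K i ^ 2))
  rw [integral_finsetSum s fun i _ => (hRi i).div_const (K i ^ 2)] at hx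
  simp_rw [integral_div] at hx
  have hx2 : ∑ i ∈ s, R i x / K i ^ 2 < ε ^ 2 := by
    refine lt_of_le_of_lt (hx.trans (Finset.sum_le_sum fun i hi => ?_)) hn
    have := hKpos i hi
    rw [div_le_iff₀ (by positivity), sub_mul, div_mul_cancel₀ _ (by positivity), one_mul]
    exact hRint i
  set d : SimpleGraph (Fin n) → ℝ := fun N => ∑ i ∈ s,
    (((M i).2.labeledCopies N (x ⁻¹' A i)).ncard / K i - W.tindOn (A i) (M i).2) ^ 2 with hd
  have hsum : ∑ N, W.weight N x * d N < ε ^ 2 := by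
    refine lt_of_le_of_lt ?_ hx2
    simp_rw [hd, Finset.mul_sum]
    rw [Finset.sum_comm]
    refine Finset.sum_le_sum fun i hi => ?_
    have := hKpos i hi
    rw [le_div_iff₀ (by positivity)]
    refine le_trans (le_of_eq ?_) (hR i x)
    rw [Finset.sum_mul]
    refine Finset.sum_congr rfl fun N _ => ?_
    simp only [hK] at this ⊢
    field_simp
  -- The weights are nonnegative with sum 1, so some graph does no worse than the average.
  obtain ⟨N, hN⟩ : ∃ N, d N < ε ^ 2 := by
    by_contra! hcon
    have : ε ^ 2 ≤ ∑ N, W.weight N x * d N := by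
      calc ε ^ 2 = ∑ N, W.weight N x * ε ^ 2 := by rw [← Finset.sum_mul, W.sum_weight, one_mul]
        _ ≤ _ := Finset.sum_le_sum fun N _ =>
          mul_le_mul_of_nonneg_left (hcon N) (W.weight_nonneg _ _)
    linarith
  refine ⟨x, N, fun i hi => ?_⟩
  refine abs_lt_of_sq_lt_sq (lt_of_le_of_lt ?_ hN) hε.le
  exact Finset.single_le_sum (f := fun i =>
    (((M i).2.labeledCopies N (x ⁻¹' A i)).ncard / K i - W.tindOn (A i) (M i).2) ^ 2)
    (fun _ _ => sq_nonneg _) hi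

end Sampling

end Graphon

/-! ### Restrictions are subgraphons, and the induction -/

namespace Graphon

section Subgraphon

variable {X : Type*} [MeasurableSpace X] {μ : Measure X} [IsProbabilityMeasure μ] (W : Graphon μ)

/-- The limit object represented by the restriction of `W` to `A`, with `μ` conditioned on `A`. -/
noncomputable def limitOn (A : Set X) : FinGraph → ℝ := fun M =>
  ((Fintype.card (Fin M.1)).factorial : ℝ) / (Nat.card (M.2 ≃g M.2) : ℝ) *
    (W.tindOn A M.2 / μ.real A ^ M.1)

/-- There are countably many finite graphs, so stage `j` can treat the first `j` of them with error
`1 / (j + 1)`. The Boolean index runs over `A` and the whole space, so that the same sample serves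
both limits. -/
theorem exists_sample_sequence {A : Set X} (hA : MeasurableSet A) :
    ∃ (φ : ℕ → ℕ) (N : ∀ j, SimpleGraph (Fin (φ j))) (S : ∀ j, Set (Fin (φ j))), StrictMono φ ∧
      ∀ M : FinGraph,
        Tendsto (fun j => ((M.2.labeledCopies (N j) Set.univ).ncard : ℝ) /
          ((φ j).descFactorial M.1 : ℝ)) atTop (𝓝 (W.tind M.2)) ∧
        Tendsto (fun j => ((M.2.labeledCopies (N j) (S j)).ncard : ℝ) /
          ((φ j).descFactorial M.1 : ℝ)) atTop (𝓝 (W.tindOn A M.2)) := by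
  have : Nonempty FinGraph := ⟨⟨0, ⊥⟩⟩
  obtain ⟨e, he⟩ := exists_surjective_nat FinGraph
  have hB : ∀ i : ℕ × Bool, MeasurableSet (cond i.2 A Set.univ) := by
    rintro ⟨i, _ | _⟩
    exacts [MeasurableSet.univ, hA]
  obtain ⟨φ, hφ, h⟩ := extraction_forall_of_eventually fun j : ℕ =>
    W.eventually_exists_sample (Finset.range j ×ˢ Finset.univ) (fun i : ℕ × Bool => e i.1) hB
      (ε := 1 / ((j : ℝ) + 1)) Nat.one_div_pos_of_nat
  choose x N h using h
  refine ⟨φ, N, fun j => x j ⁻¹' A, hφ, fun M => ?_⟩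
  obtain ⟨m, rfl⟩ := he M
  have key : ∀ b : Bool, Tendsto (fun j => (((e m).2.labeledCopies (N j)
      (x j ⁻¹' cond b A Set.univ)).ncard : ℝ) / ((φ j).descFactorial (e m).1 : ℝ)) atTop
      (𝓝 (W.tindOn (cond b A Set.univ) (e m).2)) := by
    intro b
    rw [tendsto_iff_dist_tendsto_zero]
    refine squeeze_zero' (Eventually.of_forall fun _ => dist_nonneg) ?_
      tendsto_one_div_add_atTop_nhds_zero_nat
    filter_upwards [eventually_gt_atTop m] with j hj
    exact (h j (m, b) (by simp [hj])).le
  refine ⟨?_, key true⟩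
  rw [← W.tindOn_univ]
  exact key false

theorem isSubgraphon_limitOn {A : Set X} (hA : MeasurableSet A) (hpos : μ A ≠ 0) :
    IsSubgraphon (W.limitOn A) W.limit := by
  have hc : 0 < μ.real A := ENNReal.toReal_pos hpos (measure_ne_top _ _)
  obtain ⟨φ, N, S, hφ, h⟩ := W.exists_sample_sequence hA
  have hφt : Tendsto (fun j => (φ j : ℝ)) atTop atTop :=
    tendsto_natCast_atTop_atTop.comp hφ.tendsto_atTop
  have hS : Tendsto (fun j => ((S j).ncard : ℝ) / (φ j : ℝ)) atTop (𝓝 (μ.real A)) := by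
    have := (h ⟨1, ⊥⟩).2
    simpa only [SimpleGraph.ncard_labeledCopies_bot_fin_one, Nat.descFactorial_one,
      W.tindOn_bot_fin_one hA] using this
  have hSt : Tendsto (fun j => (S j).ncard) atTop atTop := by
    rw [← tendsto_natCast_atTop_iff (R := ℝ)]
    refine (hS.pos_mul_atTop hc hφt).congr' ?_
    filter_upwards [hφt.eventually_gt_atTop 0] with j hj
    field_simp
  have hSden : ∀ M : FinGraph, Tendsto (fun j => inducedDensity M.2 ((N j).induce (S j))) atTop
      (𝓝 (W.limitOn A M)) := by
    intro M
    simp_rw [inducedDensity_induce]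
    refine Tendsto.const_mul _ ?_
    -- Change of normalization: from the falling factorial of `φ j` to a power, then to a power of
    -- the size of `S j`, then (in `h2`) to its falling factorial.
    have h1 := ((h M).2.mul ((Nat.tendsto_descFactorial_div_pow M.1).comp hφ.tendsto_atTop)).div
      (hS.pow M.1) (pow_ne_zero _ hc.ne')
    have h2 := h1.div ((Nat.tendsto_descFactorial_div_pow M.1).comp hSt) one_ne_zero
    rw [mul_one, div_one] at h2
    refine h2.congr' ?_
    filter_upwards [hφ.tendsto_atTop.eventually_ge_atTop (M.1 + 1),
      hSt.eventually_ge_atTop (M.1 + 1)] with j hj hj'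
    have p1 : (0 : ℝ) < (φ j).descFactorial M.1 :=
      Nat.cast_pos.2 (Nat.descFactorial_pos.2 (by omega))
    have p2 : (0 : ℝ) < (S j).ncard.descFactorial M.1 :=
      Nat.cast_pos.2 (Nat.descFactorial_pos.2 (by omega))
    have p3 : (0 : ℝ) < φ j := Nat.cast_pos.2 (by omega)
    have p4 : (0 : ℝ) < (S j).ncard := Nat.cast_pos.2 (by omega)
    simp only [Pi.div_apply, Function.comp_apply, Fintype.card_fin, div_pow]
    field_simp
  -- The sizes of the `S j` tend to infinity but need not increase strictly, so a subsequence is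
  -- taken.
  obtain ⟨θ, hθ, hSθ⟩ := strictMono_subseq_of_tendsto_atTop hSt
  refine ⟨μ.real A, hc, fun k => ⟨φ (θ k), N (θ k)⟩, fun k => S (θ k), ⟨?_, fun M => ?_⟩,
    hS.comp hθ.tendsto_atTop, ⟨?_, fun M => (hSden M).comp hθ.tendsto_atTop⟩⟩
  · simp only [Nat.card_eq_fintype_card, Fintype.card_fin]
    exact hφ.comp hθ
  · simp_rw [inducedDensity_eq]
    refine Tendsto.const_mul _ ?_
    simp only [Nat.card_eq_fintype_card, Fintype.card_fin]
    exact (h M).1.comp hθ.tendsto_atTop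
  · simp only [Nat.card_coe_set_eq]
    exact hSθ

omit [IsProbabilityMeasure μ] in
theorem density_pos_iff {V : Type*} [Fintype V] (M : SimpleGraph V) :
    0 < W.density M ↔ 0 < W.tind M := by
  have : Finite (M ≃g M) := Finite.of_injective _ RelIso.toEquiv_injective
  have : Nonempty (M ≃g M) := ⟨RelIso.refl _⟩
  have hpos : (0 : ℝ) < Nat.card (M ≃g M) := Nat.cast_pos.2 Nat.card_pos
  exact mul_pos_iff_of_pos_left (by positivity)

/-- Weak randomness enters here: `W.limitOn A` is a subgraphon, and its value at `M` is a positive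
multiple of `W.tindOn A M`. -/
theorem WeaklyRandom.tindOn_pos {W : Graphon μ} (hW : W.WeaklyRandom) {n : ℕ}
    {M : SimpleGraph (Fin n)} (hM : 0 < W.tind M) {A : Set X} (hA : MeasurableSet A)
    (hpos : μ A ≠ 0) : 0 < W.tindOn A M := by
  have h1 : (⟨n, M⟩ : FinGraph) ∈ persistentlyPositiveGraphs W.limit := by
    rw [show persistentlyPositiveGraphs W.limit = _ from hW]
    exact (W.density_pos_iff M).2 hM
  have h2 : 0 < W.limitOn A ⟨n, M⟩ :=
    Set.mem_iInter₂.1 h1 _ (W.isSubgraphon_limitOn hA hpos)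
  have hc : 0 < μ.real A := ENNReal.toReal_pos hpos (measure_ne_top _ _)
  by_contra! hcon
  refine absurd h2 (not_lt.2 ?_)
  exact mul_nonpos_of_nonneg_of_nonpos (by positivity)
    (div_nonpos_of_nonpos_of_nonneg hcon (by positivity))

theorem tind_pos_of_isEmpty {V : Type*} [Fintype V] [IsEmpty V] (M : SimpleGraph V) :
    0 < W.tind M := by
  rw [tind_eq_integral_weight]
  simp [weight_of_subsingleton]

/-- A weakly random graphon that takes values strictly between `0` and `1` contains every finite
graph with positive density. -/
theorem WeaklyRandom.tind_pos {W : Graphon μ} (hW : W.WeaklyRandom)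
    (hE : ¬ ∀ᵐ p ∂(μ.prod μ), W.toFun p.1 p.2 = 0 ∨ W.toFun p.1 p.2 = 1) :
    ∀ {n : ℕ} (M : SimpleGraph (Fin n)), 0 < W.tind M := by
  have hEm : NullMeasurableSet {p : X × X | ¬ (W.toFun p.1 p.2 = 0 ∨ W.toFun p.1 p.2 = 1)}
      (μ.prod μ) :=
    (W.nullMeasurable' ((measurableSet_singleton 0).union (measurableSet_singleton 1))).compl
  -- A genuinely measurable subset of full measure, so that all its slices are measurable.
  obtain ⟨E, hEsub, hEmeas, hEae⟩ := hEm.exists_measurable_subset_ae_eq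
  have hE0 : (μ.prod μ) E ≠ 0 := by
    rw [measure_congr hEae]
    exact hE
  have hslice : ∃ᶠ y in ae μ, μ (Prod.mk y ⁻¹' E) ≠ 0 := by
    intro h
    exact hE0 ((Measure.measure_prod_null hEmeas).2 (h.mono fun y hy => not_not.1 hy))
  intro n
  induction n with
  | zero => exact fun M => W.tind_pos_of_isEmpty M
  | succ n ih =>
    intro M
    by_contra hcon
    have hint : Integrable (W.weight M) (Measure.pi fun _ => μ) := by
      simpa [weightOn] using W.integrable_weightOn MeasurableSet.univ M
    have h0 : ∀ᵐ x ∂(Measure.pi fun _ : Fin (n + 1) => μ), W.weight M x = 0 := by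
      refine (integral_eq_zero_iff_of_nonneg (W.weight_nonneg M) hint).1 ?_
      exact le_antisymm (not_lt.1 hcon) (integral_nonneg (W.weight_nonneg M))
    have h1 := (measurePreserving_piFinSuccAbove (fun _ : Fin (n + 1) => μ) 0).symm
      |>.quasiMeasurePreserving.ae h0
    -- A point with a non-null slice at which, by Fubini, the weight of `M` vanishes for almost
    -- every choice of the other points.
    obtain ⟨y, hy, hae⟩ := (hslice.and_eventually (Measure.ae_ae_of_ae_prod h1)).exists
    have hAm : MeasurableSet (Prod.mk y ⁻¹' E) := measurable_prodMk_left hEmeas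
    have hpos := hW.tindOn_pos (ih (M.comap Fin.succ)) hAm hy
    refine hpos.ne' (integral_eq_zero_of_ae ?_)
    filter_upwards [hae] with x hx
    change W.weight M (Fin.insertNth 0 y x) = 0 at hx
    rw [Fin.insertNth_zero'] at hx
    refine Set.indicator_apply_eq_zero.2 fun hxA => ?_
    have hxE : ∀ v, ¬ (W.toFun y (x v) = 0 ∨ W.toFun y (x v) = 1) := fun v =>
      hEsub (hxA v trivial)
    -- The vanishing factor cannot involve `y`, since `W` is strictly between 0 and 1 there; it is
    -- therefore a factor of the weight of `M` minus vertex 0.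
    rw [weight_eq_zero_iff] at hx ⊢
    obtain ⟨v, w, hvw, h⟩ := hx
    have h' : W.toFun (Fin.cons (α := fun _ => X) y x v) (Fin.cons (α := fun _ => X) y x w) = 0 ∨
        W.toFun (Fin.cons (α := fun _ => X) y x v) (Fin.cons (α := fun _ => X) y x w) = 1 :=
      h.imp And.right And.right
    induction v using Fin.cases with
    | zero =>
      induction w using Fin.cases with
      | zero => exact absurd rfl hvw
      | succ w => exact absurd (by simpa using h') (hxE w)
    | succ v =>
      induction w using Fin.cases with
      | zero => exact absurd (by simpa [W.symm' y] using h') (hxE v)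
      | succ w => exact ⟨v, w, fun h => hvw (h ▸ rfl), by simpa using h⟩

end Subgraphon

end Graphon

theorem mainTheorem5 {X : Type*} [MeasurableSpace X] (μ : Measure X) [IsProbabilityMeasure μ]
    (W : Graphon μ) (hW : W.WeaklyRandom)
    (hG : ∃ G : FinGraph, W.density G.2 = 0) :
    ∀ᵐ p ∂(μ.prod μ), W.toFun p.1 p.2 = 0 ∨ W.toFun p.1 p.2 = 1 := by
  by_contra hE
  obtain ⟨G, hG⟩ := hG
  exact ((W.density_pos_iff G.2).2 (hW.tind_pos hE G.2)).ne' hG
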